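/- Let $p$ be a prime, $m\in\{0,1,2,\dots\}\cup\{\infty\}$, and let $s\in\mathbf C$ with $0<|s|<1$. For $x\in\mathbf Z_p$ write $x=\sum_{n\ge0}x_np^n$ with $x_n\in\{0,\dots,p-1\}$, put $x_n=0$ for $n<0$, let $v(x)$ be the $p$-adic valuation and $|x|_p=p^{-v(x)}$. Let $D_s=-1/\log_p|s|$ and $\alpha=1/D_s$. Let $\mathbf T_p=(\mathbf R\times\mathbf Z_p)/B$, where $B=\{(n,-n):n\in\mathbf Z\}$, be the $p$-adic solenoid with its quotient topology and canonical projection $\phi$. Equip $\mathbf R\times\mathbf Z_p$ with $\hat\rho_\alpha((a,x),(b,y))=\max(|a-b|,|x-y|_p^\alpha)$ and $\mathbf T_p$ with the quotient metric $\rho_\alpha(f,g)=\inf\{\hat\rho_\alpha(u,v):\phi(u)=f,\ \phi(v)=g\}$. Equip $\mathbf R\times\mathbf C$ with $\hat d((\xi_1,z_1),(\xi_2,z_2))=\max(|\xi_1-\xi_2|,|z_1-z_2|)$ and $\mathbf S_1\times\mathbf C$ ($\mathbf S_1\subset\mathbf C$ the unit circle) with the quotient metric $d$ of $\hat d$ along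 $\varphi(\xi,z)=(e^{2\pi i\xi},z)$, defined by the same infimum. $\mathbf R^3$ carries the Euclidean metric. For $n\ge0$ let $\chi_n^{(m)}(x)=\exp\bigl(\frac{2\pi i}{p}\sum_{k=0}^{m}x_{n-k}p^{-k}\bigr)$, and let $\tilde\chi_n^{(m)}:\mathbf R\times\mathbf Z_p\to\mathbf C$ be the function with $\tilde\chi_n^{(m)}(\xi+l,x-l)=\tilde\chi_n^{(m)}(\xi,x)$ for all $l\in\mathbf Z$ and $$\tilde\chi_n^{(m)}(\xi,x)=\exp\Bigl(2\pi i\,\xi\,\frac{\theta(p^{m-n}-|x|_p)}{p^{\min(n,m)+1}}\Bigr)\chi_n^{(m)}(x)\qquad(-1<\xi\le0),$$ where $\theta$ is the indicator function of $[0,\infty]$. Put $\omega_s^{(m)}=\sum_{n\ge0}s^n\tilde\chi_n^{(m)}$ and $(\mathrm{id}\times\omega_s^{(m)})(\xi,x)=(\xi,\omega_s^{(m)}(\xi,x))$; let $\mathcal U_s^{(m)}:\mathbf T_p\to\mathbf S_1\times\mathbf C$ be the induced map, $\mathcal U_s^{(m)}\circ\phi=\varphi\circ(\mathrm{id}\times\omega_s^{(m)})$.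 For $a\in\mathbf C\setminus\{0\}$ let $\Omega_{s,a}^{(m)}=\sigma_a\circ\mathcal U_s^{(m)}:\mathbf T_p\to\mathbf R^3$, where $\sigma_a(e^{2\pi i\xi},z)=(x_1,x_2,x_3)$ with $x_1+ix_3=e^{2\pi i\xi}|a|(1+\operatorname{Re}(z/a))$ and $x_2=|a|\operatorname{Im}(z/a)$. Finally put $$\tilde\Delta_s^m=\inf_{\xi\in\mathbf R,\;x\ne y\in\mathbf Z_p}\bigl|s^{-v(x-y)}\bigl(\omega_s^{(m)}(\xi,x)-\omega_s^{(m)}(\xi,y)\bigr)\bigr|,\qquad \gamma_{s,a}^m=-\inf_{(\xi,x)\in\mathbf R\times\mathbf Z_p}\operatorname{Re}\bigl(\omega_s^{(m)}(\xi,x)/a\bigr).$$ Then: 1. The maps $\mathrm{id}\times\omega_s^{(m)}$, $\mathcal U_s^{(m)}$ and, for every $a\neq0$, $\Omega_{s,a}^{(m)}$ are Lipschitz for the metrics above. 2. If $\tilde\Delta_s^m>0$, then $\mathrm{id}\times\omega_s^{(m)}$ and $\mathcal U_s^{(m)}$ are bi-Lipschitz (onto their images). If in addition $a\neq0$ and $\gamma_{s,a}^m<1$,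 then $\Omega_{s,a}^{(m)}$ is bi-Lipschitz onto its image; it is a topological embedding of $\mathbf T_p$ in $\mathbf R^3$, and the Hausdorff dimension of $\Omega_{s,a}^{(m)}(\mathbf T_p)$, as well as its local Hausdorff dimension at each of its points (the infimum of the Hausdorff dimensions of its intersections with open neighbourhoods of the point), equals $D_s+1$. -/

import Mathlib

namespace PadicSolenoid

noncomputable section

/-! ### Lipschitz maps for explicitly given distance functions -/

/-- `Φ` is an L-contraction (a Lipschitz map): `d (Φ x) (Φ y) ≤ C * ρ x y` for some `C > 0`. -/
def IsLContraction {M N : Type*} (ρ : M → M → ℝ) (d : N → N → ℝ) (Φ : M → N) : Prop :=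
  ∃ C : ℝ, 0 < C ∧ ∀ x y : M, d (Φ x) (Φ y) ≤ C * ρ x y

/-- `Φ` is an L-isometry (a bi-Lipschitz map): `ρ` and `d (Φ ·) (Φ ·)` bound each other up to
positive multiplicative constants. -/
def IsLIsometry {M N : Type*} (ρ : M → M → ℝ) (d : N → N → ℝ) (Φ : M → N) : Prop :=
  IsLContraction ρ d Φ ∧ ∃ C : ℝ, 0 < C ∧ ∀ x y : M, ρ x y ≤ C * d (Φ x) (Φ y)

/-- The quotient distance along `π : X → Y`: the infimum of `ρ a b` over all `a`, `b` lying over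
`f`, `g`. -/
def quotDist {X Y : Type*} (π : X → Y) (ρ : X → X → ℝ) (f g : Y) : ℝ :=
  sInf {r : ℝ | ∃ a b : X, π a = f ∧ π b = g ∧ r = ρ a b}

/-- The local Hausdorff dimension of `A` at `x`: the infimum of the Hausdorff dimensions of
`A ∩ U` over the open neighbourhoods `U` of `x`. -/
def localDimH {X : Type*} [EMetricSpace X] (A : Set X) (x : X) : ENNReal :=
  ⨅ (U : Set X) (_ : IsOpen U) (_ : x ∈ U), dimH (A ∩ U)

variable (p : ℕ) [Fact p.Prime]

/-! ### The solenoid and the metrics -/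

/-- The metric `max (|a - b|, |x - y|_p ^ α)` on `ℝ × ℤ_p`. -/
def rhoHat (α : ℝ) (u v : ℝ × ℤ_[p]) : ℝ :=
  max |u.1 - v.1| (‖u.2 - v.2‖ ^ α)

/-- The subgroup `B = {(n, -n) : n ∈ ℤ}` of `ℝ × ℤ_p`. -/
def B : AddSubgroup (ℝ × ℤ_[p]) :=
  AddSubgroup.zmultiples ((1 : ℝ), (-1 : ℤ_[p]))

/-- The `p`-adic solenoid `(ℝ × ℤ_p) / B`, with its quotient topology. -/
abbrev Solenoid : Type := (ℝ × ℤ_[p]) ⧸ B p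

/-- The canonical projection of `ℝ × ℤ_p` onto the solenoid. -/
def proj (u : ℝ × ℤ_[p]) : Solenoid p := QuotientAddGroup.mk u

/-- The quotient metric `ρ_α` on the solenoid. -/
def rho (α : ℝ) : Solenoid p → Solenoid p → ℝ :=
  quotDist (proj p) (rhoHat p α)

/-- The metric `max (|ξ₁ - ξ₂|, |z₁ - z₂|)` on `ℝ × ℂ`. -/
def dHat (u v : ℝ × ℂ) : ℝ := max |u.1 - v.1| ‖u.2 - v.2‖

/-- The canonical projection `(ξ, z) ↦ (exp (2πiξ), z)` of `ℝ × ℂ` onto `S¹ × ℂ`. -/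
def cylProj (u : ℝ × ℂ) : Circle × ℂ := (Circle.exp (2 * Real.pi * u.1), u.2)

/-- The quotient metric on `S¹ × ℂ`. -/
def dCyl : Circle × ℂ → Circle × ℂ → ℝ := quotDist cylProj dHat

/-! ### The maps -/

variable {p}

/-- The `n`-th digit `x_n ∈ {0, …, p - 1}` in the expansion `x = ∑ x_n p ^ n` of `x ∈ ℤ_p`:
`x.appr (n + 1)` is the natural number `x_0 + x_1 p + ⋯ + x_n p ^ n`. -/
def digit (x : ℤ_[p]) (n : ℕ) : ℕ := x.appr (n + 1) / p ^ n

open Classical in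
/-- `χ_n^{(m)}(x) = exp ((2πi / p) ∑_{k=0}^m x_{n-k} p^{-k})`; the digits of negative index
of `x ∈ ℤ_p` are zero, so that the sum runs over `k ≤ min n m`. -/
def chi (m : ℕ∞) (n : ℕ) (x : ℤ_[p]) : ℂ :=
  Complex.exp (Complex.I * 2 * Real.pi / p *
    ∑ k ∈ (Finset.range (n + 1)).filter (fun k : ℕ => (k : ℕ∞) ≤ m),
      (digit x (n - k) : ℂ) / (p : ℂ) ^ k)

open Classical in
/-- `θ (p^{m-n} - |x|_p)`, where `θ` is the indicator function of `[0, ∞]`. -/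
def thetaFactor (m : ℕ∞) (n : ℕ) (x : ℤ_[p]) : ℝ :=
  if m = ⊤ ∨ ‖x‖ ≤ (p : ℝ) ^ ((m.toNat : ℤ) - (n : ℤ)) then 1 else 0

/-- `exp (2πiξ θ (p^{m-n} - |x|_p) / p^{min(n,m)+1}) χ_n^{(m)}(x)`. -/
def chiLocal (m : ℕ∞) (n : ℕ) (ξ : ℝ) (x : ℤ_[p]) : ℂ :=
  Complex.exp (Complex.I * 2 * Real.pi * ξ *
    ((thetaFactor m n x : ℂ) / (p : ℂ) ^ ((min (n : ℕ∞) m).toNat + 1))) * chi m n x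

/-- The function on `ℝ × ℤ_p` which is constant on the cosets of `B` and is given by `chiLocal`
on the fundamental domain `(-1, 0] × ℤ_p`. -/
def chiTilde (m : ℕ∞) (n : ℕ) (u : ℝ × ℤ_[p]) : ℂ :=
  chiLocal m n (u.1 - (⌈u.1⌉ : ℝ)) (u.2 + (⌈u.1⌉ : ℤ_[p]))

theorem chiTilde_eq_of_mem (m : ℕ∞) (n : ℕ) (ξ : ℝ) (x : ℤ_[p]) (h1 : -1 < ξ) (h2 : ξ ≤ 0) :
    chiTilde m n (ξ, x) = chiLocal m n ξ x := by
  have h : ⌈ξ⌉ = 0 := by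
    rw [Int.ceil_eq_iff]
    constructor
    · simpa using h1
    · simpa using h2
  simp [chiTilde, h]

theorem chiTilde_shift (m : ℕ∞) (n : ℕ) (ξ : ℝ) (x : ℤ_[p]) (l : ℤ) :
    chiTilde m n (ξ + l, x - (l : ℤ_[p])) = chiTilde m n (ξ, x) := by
  simp only [chiTilde, Int.ceil_add_intCast, Int.cast_add]
  congr 1 <;> ring

/-- `ω_s^{(m)}(ξ, x) = ∑ s^n χ̃_n^{(m)}(ξ, x)`. -/
def omega (m : ℕ∞) (s : ℂ) (u : ℝ × ℤ_[p]) : ℂ :=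
  ∑' n : ℕ, s ^ n * chiTilde m n u

theorem omega_shift (m : ℕ∞) (s : ℂ) (ξ : ℝ) (x : ℤ_[p]) (l : ℤ) :
    omega m s (ξ + l, x - (l : ℤ_[p])) = omega m s (ξ, x) := by
  simp only [omega, chiTilde_shift]

/-- The map `id × ω_s^{(m)} : ℝ × ℤ_p → ℝ × ℂ`, `(ξ, x) ↦ (ξ, ω_s^{(m)}(ξ, x))`. -/
def idOmega (m : ℕ∞) (s : ℂ) (u : ℝ × ℤ_[p]) : ℝ × ℂ := (u.1, omega m s u)

theorem cylProj_idOmega_eq (m : ℕ∞) (s : ℂ) (u v : ℝ × ℤ_[p])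
    (h : (QuotientAddGroup.leftRel (B p)) u v) :
    cylProj (idOmega m s u) = cylProj (idOmega m s v) := by
  rw [QuotientAddGroup.leftRel_apply] at h
  obtain ⟨l, hl⟩ := AddSubgroup.mem_zmultiples_iff.1 h
  have hv : v = (u.1 + (l : ℝ), u.2 - (l : ℤ_[p])) := by
    have h1 := congrArg Prod.fst hl
    have h2 := congrArg Prod.snd hl
    simp at h1 h2
    refine Prod.ext ?_ ?_
    · linear_combination -h1
    · linear_combination -h2
  subst hv
  simp only [cylProj, idOmega, Prod.mk.injEq]
  refine ⟨?_, (omega_shift m s u.1 u.2 l).symm⟩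
  have h3 : 2 * Real.pi * (u.1 + (l : ℝ)) = 2 * Real.pi * u.1 + l * (2 * Real.pi) := by ring
  rw [h3]
  exact (Circle.periodic_exp.int_mul l (2 * Real.pi * u.1)).symm

/-- The quotient map `T_p → S¹ × ℂ` of `id × ω_s^{(m)}`:
the class of `(ξ, x)` goes to `(exp (2πiξ), ω_s^{(m)}(ξ, x))`. -/
def U (m : ℕ∞) (s : ℂ) : Solenoid p → Circle × ℂ :=
  Quotient.lift (fun u : ℝ × ℤ_[p] => cylProj (idOmega m s u)) (cylProj_idOmega_eq m s)

theorem U_proj (m : ℕ∞) (s : ℂ) (u : ℝ × ℤ_[p]) :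
    U m s (proj p u) = cylProj (idOmega m s u) := rfl

/-- `σ_a : S¹ × ℂ → ℝ³`, `(w, z) ↦ (x₁, x₂, x₃)` with
`x₁ + i x₃ = w |a| (1 + Re (z / a))` and `x₂ = |a| Im (z / a)`. -/
def sigma (a : ℂ) (q : Circle × ℂ) : EuclideanSpace ℝ (Fin 3) :=
  !₂[(q.1 : ℂ).re * (‖a‖ * (1 + (q.2 / a).re)),
     ‖a‖ * (q.2 / a).im,
     (q.1 : ℂ).im * (‖a‖ * (1 + (q.2 / a).re))]

/-- `Ω_{s,a}^{(m)} = σ_a ∘ U_s^{(m)} : T_p → ℝ³`. -/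
def Omega (m : ℕ∞) (s a : ℂ) (f : Solenoid p) : EuclideanSpace ℝ (Fin 3) :=
  sigma a (U m s f)

variable (p)

/-! ### The numerical parameters -/

/-- The scaling dimension `D_s = -1 / log_p |s|`. -/
def scalingDim (s : ℂ) : ℝ := -(Real.logb p ‖s‖)⁻¹

/-- The infimum of `|s^{-v(x-y)} (ω_s^{(m)}(ξ, x) - ω_s^{(m)}(ξ, y))|` over `ξ ∈ ℝ` and
`x ≠ y` in `ℤ_p`. -/
def deltaTilde (m : ℕ∞) (s : ℂ) : ℝ :=
  sInf {r : ℝ | ∃ (x y : ℤ_[p]) (ξ : ℝ), x ≠ y ∧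
    r = ‖s ^ (-((x - y).valuation : ℤ)) * (omega m s (ξ, x) - omega m s (ξ, y))‖}

/-- `γ_{s,a}^m = - inf Re (ω_s^{(m)} / a)`. -/
def gamma (m : ℕ∞) (s a : ℂ) : ℝ :=
  - ⨅ u : ℝ × ℤ_[p], (omega m s u / a).re

end

end PadicSolenoid

/-!
Write `q = ‖s‖`, so that `‖x‖ ^ α = q ^ v(x)` on `ℤ_p`.

**The maps are Lipschitz.** The `n`-th building block `χ̃_n` is `exp (i t)` for a real phase `t`
that depends only on `ξ` and on the truncation `x.appr (n + 1)` of `x` (`chiLocal_eq_exp`). Hence, for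
`x ≡ y` modulo `p ^ N`, the difference `ω(ξ, x) - ω(ξ, y)` is a geometric tail of size `O(q ^ N)`
(`norm_omega_sub_le_padic`). In the real variable the pieces on consecutive unit intervals are
`2π`-Lipschitz and match at the integers, because the factor `θ` is `1` exactly when subtracting `1`
from `x` changes the digits entering `χ_n` (`chiLocal_neg_one`). So `ω` is Lipschitz, and Lipschitz
bounds pass to the quotients.

**The maps are bi-Lipschitz.** If `0 < deltaTilde`, then `‖x - y‖ ^ α` is at most a multiple of
`‖ω(ξ, x) - ω(ξ, y)‖`, which with the Lipschitz bound in `ξ` gives the lower bound for `id × ω`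
(`exists_rhoHat_le_dHat_idOmega`). It descends to `U` since every point of `ℝ × ℂ` above `U f`
is the image of a representative of `f`. If `gamma < 1`, the image stays at a positive
distance from the axis of rotation, where `sigma` is bi-Lipschitz in cylindrical coordinates
(`dHat_le_dist_sigma`). This yields a lower bound for `Omega` on representatives whose
real coordinates differ by at most `1 / 2` (`exists_rhoHat_le_dist_Omega`), and any two classes have
such representatives. The solenoid is compact, so the injective continuous map `Omega` is an
embedding.

**The dimension.** Cutting `[0, 1) × ℤ_p` into about `q ^ (-N) * p ^ N` cells of diameter `q ^ N`
shows that the Hausdorff measure of the image in dimension `1 / α + 1` is finite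
(`hausdorffMeasure_image_ne_top`). Conversely the image of the product of Lebesgue and Haar measure
gives mass `O(r ^ (1 / α + 1))` to sets of diameter `r`, so by the mass distribution principle the
image of every nonempty open set has positive Hausdorff measure in that dimension
(`hausdorffMeasure_image_ne_zero`). This treats the global and the local dimension at once.
-/

namespace PadicSolenoid

open MeasureTheory Filter Topology

variable {p : ℕ} [Fact p.Prime]

/-! ### Digits of `p`-adic integers -/

theorem appr_eq_of_sub_mem {n a : ℕ} {x : ℤ_[p]} (ha : a < p ^ n)
    (h : x - a ∈ Ideal.span {(p : ℤ_[p]) ^ n}) : x.appr n = a := by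
  have h1 := PadicInt.zmod_congr_of_sub_mem_span n x _ _ (PadicInt.appr_spec n x) h
  rw [ZMod.natCast_eq_natCast_iff] at h1
  exact h1.eq_of_lt_of_lt (PadicInt.appr_lt x n) ha

theorem appr_eq_appr {n : ℕ} {x y : ℤ_[p]} (h : ‖x - y‖ ≤ (p : ℝ) ^ (-n : ℤ)) :
    x.appr n = y.appr n := by
  rw [PadicInt.norm_le_pow_iff_mem_span_pow] at h
  refine appr_eq_of_sub_mem (PadicInt.appr_lt y n) ?_
  have := add_mem h (PadicInt.appr_spec n y)
  rwa [sub_add_sub_cancel] at this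

theorem appr_eq_mod (x : ℤ_[p]) {i n : ℕ} (h : i ≤ n) : x.appr i = x.appr n % p ^ i := by
  have h1 := (Nat.modEq_iff_dvd' (PadicInt.appr_mono x h)).2 (PadicInt.dvd_appr_sub_appr x i n h)
  rw [← h1, Nat.mod_eq_of_lt (PadicInt.appr_lt x i)]

theorem digit_eq (x : ℤ_[p]) {i n : ℕ} (h : i ≤ n) :
    digit x i = x.appr (n + 1) / p ^ i % p := by
  rw [digit, appr_eq_mod x (Nat.succ_le_succ h), pow_succ, Nat.mod_mul_right_div_self]

theorem pow_dvd_appr_iff (x : ℤ_[p]) {j n : ℕ} (h : j ≤ n) :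
    p ^ j ∣ x.appr n ↔ ‖x‖ ≤ (p : ℝ) ^ (-j : ℤ) := by
  rw [Nat.dvd_iff_mod_eq_zero, ← appr_eq_mod x h]
  constructor
  · intro h0
    rw [PadicInt.norm_le_pow_iff_mem_span_pow]
    simpa [h0] using PadicInt.appr_spec j x
  · intro h0
    have hp : 0 < p ^ j := pow_pos (Fact.out : p.Prime).pos _
    refine appr_eq_of_sub_mem hp ?_
    rw [PadicInt.norm_le_pow_iff_mem_span_pow] at h0
    simpa using h0

/-- Subtracting `1` lowers the truncation of `x` modulo `p ^ n` by one, with a borrow if it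
vanishes. -/
theorem appr_sub_one (x : ℤ_[p]) (n : ℕ) :
    (x - 1).appr n = if x.appr n = 0 then p ^ n - 1 else x.appr n - 1 := by
  have hp : 0 < p ^ n := pow_pos (Fact.out : p.Prime).pos _
  have hx := PadicInt.appr_spec n x
  split_ifs with h0
  · refine appr_eq_of_sub_mem (by omega) ?_
    rw [h0] at hx
    have := sub_mem hx (Ideal.subset_span (Set.mem_singleton ((p : ℤ_[p]) ^ n)))
    convert this using 1
    push_cast [Nat.cast_sub (show 1 ≤ p ^ n from hp)]
    ring
  · have h1 : 1 ≤ x.appr n := Nat.one_le_iff_ne_zero.2 h0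
    refine appr_eq_of_sub_mem ((Nat.sub_le _ _).trans_lt (PadicInt.appr_lt x n)) ?_
    convert hx using 1
    push_cast [Nat.cast_sub h1]
    ring

/-! ### The building blocks as exponentials of a real phase -/

/-- `min n m`, so that `window m n + 1` is the number of digits entering `χ_n^{(m)}`. -/
noncomputable def window (m : ℕ∞) (n : ℕ) : ℕ := (min (n : ℕ∞) m).toNat

theorem coe_window (m : ℕ∞) (n : ℕ) : (window m n : ℕ∞) = min (n : ℕ∞) m :=
  ENat.natCast_toNat (ne_top_of_le_ne_top (ENat.natCast_ne_top n) (min_le_left _ _))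

theorem window_le (m : ℕ∞) (n : ℕ) : window m n ≤ n := by
  have : (window m n : ℕ∞) ≤ n := by rw [coe_window]; exact min_le_left _ _
  exact_mod_cast this

/-- The number written by the digits of index `n - min n m, …, n` of `x`. -/
noncomputable def topDigits (m : ℕ∞) (n : ℕ) (x : ℤ_[p]) : ℕ :=
  x.appr (n + 1) / p ^ (n - window m n)

open Classical in
theorem filter_range_eq (m : ℕ∞) (n : ℕ) :
    (Finset.range (n + 1)).filter (fun k : ℕ => (k : ℕ∞) ≤ m) = Finset.range (window m n + 1) := by
  ext k
  have h : (k : ℕ∞) ≤ window m n ↔ (k : ℕ∞) ≤ n ∧ (k : ℕ∞) ≤ m := by rw [coe_window, le_min_iff]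
  simp only [Nat.cast_le] at h
  simp only [Finset.mem_filter, Finset.mem_range, Nat.lt_succ_iff]
  exact h.symm

theorem sum_digit_div_pow (x : ℤ_[p]) (n : ℕ) {M : ℕ} (hM : M ≤ n) :
    ∑ k ∈ Finset.range (M + 1), (digit x (n - k) : ℂ) / (p : ℂ) ^ k =
      ((x.appr (n + 1) / p ^ (n - M) : ℕ) : ℂ) / (p : ℂ) ^ M := by
  have hp : (p : ℂ) ≠ 0 := Nat.cast_ne_zero.2 (Fact.out : p.Prime).ne_zero
  induction M with
  | zero => simp [digit]
  | succ M ih =>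
    rw [Finset.sum_range_succ, ih (by omega), digit_eq x (Nat.sub_le n (M + 1))]
    have h1 : n - M = n - (M + 1) + 1 := by omega
    have h2 := Nat.div_add_mod (x.appr (n + 1) / p ^ (n - (M + 1))) p
    rw [Nat.div_div_eq_div_mul, ← pow_succ, ← h1] at h2
    have h3 : ((x.appr (n + 1) / p ^ (n - (M + 1)) : ℕ) : ℂ) =
        p * ((x.appr (n + 1) / p ^ (n - M) : ℕ) : ℂ) +
          ((x.appr (n + 1) / p ^ (n - (M + 1)) % p : ℕ) : ℂ) := by
      exact_mod_cast h2.symm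
    rw [h3]
    field_simp
    ring

theorem thetaFactor_eq (m : ℕ∞) (n : ℕ) (x : ℤ_[p]) :
    thetaFactor m n x = if p ^ (n - window m n) ∣ x.appr (n + 1) then 1 else 0 := by
  have hp : (1 : ℝ) ≤ p := by exact_mod_cast (Fact.out : p.Prime).one_lt.le
  unfold thetaFactor
  refine if_congr ?_ rfl rfl
  rw [pow_dvd_appr_iff x ((Nat.sub_le _ _).trans n.le_succ)]
  induction m using ENat.recTopCoe with
  | top =>
    have : window ⊤ n = n := by simp [window]
    simpa [this] using PadicInt.norm_le_one x
  | coe m =>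
    simp only [ENat.natCast_ne_top, false_or, ENat.toNat_natCast]
    rcases le_total n m with h | h
    · have hw : window m n = n := by simp [window, h]
      have h1 : ‖x‖ ≤ (p : ℝ) ^ ((m : ℤ) - n) :=
        (PadicInt.norm_le_one x).trans (one_le_zpow₀ hp (by omega))
      simpa [hw, h1] using PadicInt.norm_le_one x
    · have hw : window m n = m := by simp [window, h]
      rw [hw, Nat.cast_sub h, neg_sub]

/-- The real number `t` with `chiLocal m n ξ x = exp (i t)`. -/
noncomputable def phase (m : ℕ∞) (n : ℕ) (ξ : ℝ) (x : ℤ_[p]) : ℝ :=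
  2 * Real.pi * ((ξ * thetaFactor m n x + topDigits m n x) / p ^ (window m n + 1))

theorem chiLocal_eq_exp (m : ℕ∞) (n : ℕ) (ξ : ℝ) (x : ℤ_[p]) :
    chiLocal m n ξ x = Complex.exp (Complex.I * (phase m n ξ x : ℝ)) := by
  have hp : (p : ℂ) ≠ 0 := Nat.cast_ne_zero.2 (Fact.out : p.Prime).ne_zero
  rw [chiLocal, chi, filter_range_eq, sum_digit_div_pow x n (window_le m n), ← Complex.exp_add,
    phase, topDigits]
  congr 1
  change Complex.I * 2 * Real.pi * ξ * ((thetaFactor m n x : ℂ) / (p : ℂ) ^ (window m n + 1)) + _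
    = _
  push_cast
  field_simp
  ring

theorem norm_chiLocal (m : ℕ∞) (n : ℕ) (ξ : ℝ) (x : ℤ_[p]) : ‖chiLocal m n ξ x‖ = 1 := by
  rw [chiLocal_eq_exp, Complex.norm_exp_I_mul_ofReal]

/-- The building block of index `n` only sees `x` modulo `p ^ (n + 1)`. -/
theorem chiLocal_congr (m : ℕ∞) (n : ℕ) (ξ : ℝ) {x y : ℤ_[p]}
    (h : ‖x - y‖ ≤ (p : ℝ) ^ (-(n + 1 : ℕ) : ℤ)) : chiLocal m n ξ x = chiLocal m n ξ y := by
  simp only [chiLocal_eq_exp, phase, thetaFactor_eq, topDigits, appr_eq_appr h]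

/-- The two pieces of `chiTilde` match at the gluing point: moving `ξ` from `0` to `-1`
has the same effect as subtracting `1` from `x`. -/
theorem chiLocal_neg_one (m : ℕ∞) (n : ℕ) (x : ℤ_[p]) :
    chiLocal m n (-1) x = chiLocal m n 0 (x - 1) := by
  have hp : 0 < p := (Fact.out : p.Prime).pos
  rw [chiLocal_eq_exp, chiLocal_eq_exp]
  simp only [phase, thetaFactor_eq, topDigits, appr_sub_one]
  have hw : window m n + 1 + (n - window m n) = n + 1 := by have := window_le m n; omega
  generalize window m n = M at *
  generalize n - M = j at *
  generalize x.appr (n + 1) = X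
  rcases Nat.eq_zero_or_pos X with rfl | hX
  · -- all the relevant digits of `x - 1` are `p - 1`: the phases differ by a full turn
    have h1 : (p ^ (n + 1) - 1) / p ^ j = p ^ (M + 1) - 1 := by
      have hj : 0 < p ^ j := pow_pos hp _
      obtain ⟨A, hA⟩ : ∃ A, p ^ (M + 1) = A + 1 :=
        Nat.exists_eq_succ_of_ne_zero (pow_pos hp _).ne'
      have h : (A + 1) * p ^ j - 1 = p ^ j - 1 + A * p ^ j := by rw [add_mul, one_mul]; omega
      rw [← hw, pow_add, hA, h, Nat.add_mul_div_right _ _ hj, Nat.div_eq_of_lt (by omega)]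
      omega
    have h2 : (1 : ℕ) ≤ p ^ (M + 1) := pow_pos hp _
    simp only [dvd_zero, if_true, Nat.zero_div, h1]
    rw [← Complex.exp_periodic]
    congr 1
    push_cast [Nat.cast_sub h2]
    have : (p : ℂ) ≠ 0 := Nat.cast_ne_zero.2 hp.ne'
    field_simp
    ring
  · obtain ⟨Y, rfl⟩ : ∃ Y, X = Y + 1 := ⟨X - 1, by omega⟩
    simp only [Nat.add_sub_cancel, Nat.succ_ne_zero, if_false, Nat.succ_div]
    congr 3
    split_ifs <;> push_cast <;> ring

theorem norm_exp_I_mul_sub_le (a b : ℝ) :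
    ‖Complex.exp (Complex.I * a) - Complex.exp (Complex.I * b)‖ ≤ |a - b| := by
  have h : Complex.exp (Complex.I * a) - Complex.exp (Complex.I * b) =
      Complex.exp (Complex.I * b) * (Complex.exp (Complex.I * ((a - b : ℝ) : ℂ)) - 1) := by
    rw [mul_sub, ← Complex.exp_add]
    push_cast
    ring_nf
  rw [h, norm_mul, Complex.norm_exp_I_mul_ofReal, one_mul]
  exact Real.norm_exp_I_mul_ofReal_sub_one_le

theorem norm_chiLocal_sub_le (m : ℕ∞) (n : ℕ) (ξ η : ℝ) (x : ℤ_[p]) :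
    ‖chiLocal m n ξ x - chiLocal m n η x‖ ≤ 2 * Real.pi * |ξ - η| := by
  have hp : (1 : ℝ) ≤ p := by exact_mod_cast (Fact.out : p.Prime).one_lt.le
  rw [chiLocal_eq_exp, chiLocal_eq_exp]
  refine (norm_exp_I_mul_sub_le _ _).trans ?_
  have h1 : phase m n ξ x - phase m n η x =
      2 * Real.pi * ((ξ - η) * (thetaFactor m n x / p ^ (window m n + 1))) := by
    simp only [phase]; ring
  have hpow : (1 : ℝ) ≤ (p : ℝ) ^ (window m n + 1) := one_le_pow₀ hp
  have h2 : |thetaFactor m n x / (p : ℝ) ^ (window m n + 1)| ≤ 1 := by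
    rw [abs_div, abs_of_nonneg (zero_le_one.trans hpow)]
    refine div_le_one_of_le₀ ?_ (zero_le_one.trans hpow)
    refine le_trans ?_ hpow
    rw [thetaFactor_eq]
    split_ifs <;> simp
  rw [h1, abs_mul, abs_mul (ξ - η), abs_of_pos Real.two_pi_pos]
  have := abs_nonneg (ξ - η)
  have := Real.two_pi_pos
  gcongr
  nlinarith

/-! ### Lipschitz dependence of `chiTilde` on the real coordinate -/

theorem norm_chiTilde (m : ℕ∞) (n : ℕ) (u : ℝ × ℤ_[p]) : ‖chiTilde m n u‖ = 1 :=
  norm_chiLocal _ _ _ _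

theorem chiTilde_eq_of_mem_Icc (m : ℕ∞) (n : ℕ) (x : ℤ_[p]) (k : ℤ) {ξ : ℝ}
    (h1 : (k : ℝ) - 1 ≤ ξ) (h2 : ξ ≤ k) :
    chiTilde m n (ξ, x) = chiLocal m n (ξ - k) (x + (k : ℤ_[p])) := by
  rcases h1.eq_or_lt with h | h
  · have hc : ⌈ξ⌉ = k - 1 := by rw [← h, ← Int.cast_one, ← Int.cast_sub, Int.ceil_intCast]
    have h3 : ξ - k = -1 := by rw [← h]; ring
    rw [h3, chiLocal_neg_one, chiTilde]
    simp only [hc]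
    congr 1
    · rw [← h]; push_cast; ring
    · push_cast; ring
  · have hc : ⌈ξ⌉ = k := Int.ceil_eq_iff.2 ⟨h, h2⟩
    simp only [chiTilde, hc]

/-- A function on `ℝ` which is `C`-Lipschitz between consecutive integers is `C`-Lipschitz. -/
theorem norm_sub_le_of_piecewise {E : Type*} [SeminormedAddCommGroup E] {f : ℝ → E} {C : ℝ}
    (h : ∀ (k : ℤ) (a b : ℝ), (k : ℝ) - 1 ≤ a → a ≤ b → b ≤ k → ‖f b - f a‖ ≤ C * (b - a))
    {a b : ℝ} (hab : a ≤ b) : ‖f b - f a‖ ≤ C * (b - a) := by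
  suffices H : ∀ (d : ℕ) (a b : ℝ), a ≤ b → b ≤ ⌈a⌉ + d → ‖f b - f a‖ ≤ C * (b - a) by
    refine H ⌈b - a⌉₊ a b hab ?_
    have := Nat.le_ceil (b - a)
    have := Int.le_ceil a
    linarith
  intro d
  induction d with
  | zero =>
    intro a b hab hb
    have := Int.ceil_lt_add_one a
    exact h ⌈a⌉ a b (by linarith) hab (by simpa using hb)
  | succ d ih =>
    intro a b hab hb
    rcases le_total b (⌈a⌉ + d) with h1 | h1
    · exact ih a b hab h1
    · have hd : (0 : ℝ) ≤ d := Nat.cast_nonneg d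
      have ha := Int.le_ceil a
      have h2 := ih a (⌈a⌉ + d) (by linarith) le_rfl
      have h3 := h (⌈a⌉ + d + 1) (⌈a⌉ + d) b (by push_cast; linarith) h1
        (by push_cast at hb ⊢; linarith)
      calc ‖f b - f a‖ ≤ ‖f b - f (⌈a⌉ + d)‖ + ‖f (⌈a⌉ + d) - f a‖ :=
            norm_sub_le_norm_sub_add_norm_sub _ _ _
        _ ≤ _ := by linarith

theorem norm_chiTilde_sub_le (m : ℕ∞) (n : ℕ) (ξ η : ℝ) (x : ℤ_[p]) :
    ‖chiTilde m n (ξ, x) - chiTilde m n (η, x)‖ ≤ 2 * Real.pi * |ξ - η| := by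
  have key : ∀ a b : ℝ, a ≤ b →
      ‖chiTilde m n (b, x) - chiTilde m n (a, x)‖ ≤ 2 * Real.pi * (b - a) := by
    intro a b hab
    refine norm_sub_le_of_piecewise (f := fun ξ => chiTilde m n (ξ, x)) ?_ hab
    intro k a b h1 h2 h3
    rw [chiTilde_eq_of_mem_Icc m n x k h1 (h2.trans h3),
      chiTilde_eq_of_mem_Icc m n x k (h1.trans h2) h3]
    refine (norm_chiLocal_sub_le _ _ _ _ _).trans_eq ?_
    rw [sub_sub_sub_cancel_right, abs_of_nonneg (sub_nonneg.2 h2)]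
  rcases le_total ξ η with h | h
  · rw [norm_sub_rev, abs_sub_comm, abs_of_nonneg (sub_nonneg.2 h)]
    exact key _ _ h
  · rw [abs_of_nonneg (sub_nonneg.2 h)]
    exact key _ _ h

/-! ### Lipschitz estimates for `omega` -/

section Omega

variable {s : ℂ}

theorem summable_omega (hs1 : ‖s‖ < 1) (m : ℕ∞) (u : ℝ × ℤ_[p]) :
    Summable fun n : ℕ => s ^ n * chiTilde m n u := by
  refine Summable.of_norm_bounded (summable_geometric_of_lt_one (norm_nonneg s) hs1) fun n => ?_
  rw [norm_mul, norm_chiTilde, mul_one, norm_pow]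

theorem norm_omega_le (hs1 : ‖s‖ < 1) (m : ℕ∞) (u : ℝ × ℤ_[p]) : ‖omega m s u‖ ≤ (1 - ‖s‖)⁻¹ := by
  refine tsum_of_norm_bounded (hasSum_geometric_of_lt_one (norm_nonneg s) hs1) fun n => ?_
  rw [norm_mul, norm_chiTilde, mul_one, norm_pow]

theorem norm_omega_sub_le_real (hs1 : ‖s‖ < 1) (m : ℕ∞) (ξ η : ℝ) (x : ℤ_[p]) :
    ‖omega m s (ξ, x) - omega m s (η, x)‖ ≤ (1 - ‖s‖)⁻¹ * (2 * Real.pi * |ξ - η|) := by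
  rw [omega, omega, ← (summable_omega hs1 m _).tsum_sub (summable_omega hs1 m _)]
  refine tsum_of_norm_bounded
    ((hasSum_geometric_of_lt_one (norm_nonneg s) hs1).mul_right _) fun n => ?_
  rw [← mul_sub, norm_mul, norm_pow]
  gcongr
  exact norm_chiTilde_sub_le m n ξ η x

/-- If `x` and `y` agree modulo `p ^ N` then only the terms of index at least `N` contribute to the
difference. -/
theorem norm_omega_sub_le_padic (hs1 : ‖s‖ < 1) (m : ℕ∞) (ξ : ℝ) {x y : ℤ_[p]} {N : ℕ}
    (h : ‖x - y‖ ≤ (p : ℝ) ^ (-N : ℤ)) :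
    ‖omega m s (ξ, x) - omega m s (ξ, y)‖ ≤ (1 - ‖s‖)⁻¹ * 2 * ‖s‖ ^ N := by
  have hp : (1 : ℝ) ≤ p := by exact_mod_cast (Fact.out : p.Prime).one_lt.le
  rw [omega, omega, ← (summable_omega hs1 m _).tsum_sub (summable_omega hs1 m _)]
  have hz : ∀ n ∈ Finset.range N,
      s ^ n * chiTilde m n (ξ, x) - s ^ n * chiTilde m n (ξ, y) = 0 := by
    intro n hn
    rw [chiTilde, chiTilde, chiLocal_congr m n _ (y := y + (⌈ξ⌉ : ℤ_[p])), sub_self]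
    simp only [add_sub_add_right_eq_sub]
    refine h.trans (zpow_le_zpow_right₀ hp ?_)
    have := Finset.mem_range.1 hn
    omega
  rw [← ((summable_omega hs1 m _).sub (summable_omega hs1 m _)).sum_add_tsum_nat_add N,
    Finset.sum_eq_zero hz, zero_add, mul_assoc]
  refine tsum_of_norm_bounded
    ((hasSum_geometric_of_lt_one (norm_nonneg s) hs1).mul_right _) fun n => ?_
  rw [← mul_sub, norm_mul, norm_pow, pow_add]
  have h2 : ‖chiTilde m (n + N) (ξ, x) - chiTilde m (n + N) (ξ, y)‖ ≤ 2 := by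
    refine (norm_sub_le _ _).trans ?_
    rw [norm_chiTilde, norm_chiTilde]
    norm_num
  have h3 : 0 ≤ ‖s‖ ^ n * ‖s‖ ^ N := by positivity
  nlinarith

end Omega

/-! ### Quotient distances -/

section QuotDist

variable {X Y : Type*} {π : X → Y} {ρ : X → X → ℝ}

theorem quotDist_le (hρ : ∀ a b, 0 ≤ ρ a b) (a b : X) : quotDist π ρ (π a) (π b) ≤ ρ a b :=
  csInf_le ⟨0, by rintro r ⟨a, b, -, -, rfl⟩; exact hρ a b⟩ ⟨a, b, rfl, rfl, rfl⟩

theorem le_quotDist {c : ℝ} {a b : X} (h : ∀ a' b', π a' = π a → π b' = π b → c ≤ ρ a' b') :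
    c ≤ quotDist π ρ (π a) (π b) :=
  le_csInf ⟨_, a, b, rfl, rfl, rfl⟩ (by rintro r ⟨a', b', ha, hb, rfl⟩; exact h a' b' ha hb)

/-- A map out of the quotient is Lipschitz for the quotient distance as soon as it is Lipschitz
upstairs. -/
theorem IsLContraction.of_comp_proj {N : Type*} {d : N → N → ℝ} {Φ : Y → N}
    (hπ : Function.Surjective π) (h : IsLContraction ρ d (Φ ∘ π)) :
    IsLContraction (quotDist π ρ) d Φ := by
  obtain ⟨C, hC, h⟩ := h
  refine ⟨C, hC, fun f g => ?_⟩
  obtain ⟨a, rfl⟩ := hπ f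
  obtain ⟨b, rfl⟩ := hπ g
  rw [← div_le_iff₀' hC]
  refine le_quotDist fun a' b' ha hb => ?_
  rw [div_le_iff₀' hC, ← ha, ← hb]
  exact h a' b'

end QuotDist

theorem dHat_nonneg (u v : ℝ × ℂ) : 0 ≤ dHat u v := (abs_nonneg _).trans (le_max_left _ _)

theorem rhoHat_nonneg (α : ℝ) (u v : ℝ × ℤ_[p]) : 0 ≤ rhoHat p α u v :=
  (abs_nonneg _).trans (le_max_left _ _)

theorem proj_surjective : Function.Surjective (proj p) := QuotientAddGroup.mk_surjective

theorem proj_shift (u : ℝ × ℤ_[p]) (l : ℤ) :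
    proj p (u.1 + l, u.2 - (l : ℤ_[p])) = proj p u := by
  refine (QuotientAddGroup.eq.2 (AddSubgroup.mem_zmultiples_iff.2 ⟨l, ?_⟩)).symm
  refine Prod.ext ?_ ?_
  · simp
  · simp
    ring

/-- Every point over `U (proj u)` in `ℝ × ℂ` lies on the graph: it is the image of a
representative of the class of `u`. -/
theorem exists_lift_of_cylProj_eq (m : ℕ∞) (s : ℂ) (u : ℝ × ℤ_[p]) {c : ℝ × ℂ}
    (h : cylProj c = U m s (proj p u)) : ∃ u', proj p u' = proj p u ∧ idOmega m s u' = c := by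
  rw [U_proj] at h
  obtain ⟨h1, h2⟩ := Prod.mk.injEq .. ▸ h
  obtain ⟨l, hl⟩ := Circle.exp_eq_exp.1 h1
  refine ⟨(u.1 + l, u.2 - (l : ℤ_[p])), proj_shift u l, Prod.ext ?_ ?_⟩
  · have hpi := Real.two_pi_pos.ne'
    have h3 : 2 * Real.pi * (u.1 + l) = 2 * Real.pi * c.1 := by
      rw [hl]; simp only [idOmega]; ring
    exact mul_left_cancel₀ hpi h3
  · exact (omega_shift m s u.1 u.2 l).trans h2.symm

/-! ### Lipschitz and bi-Lipschitz estimates upstairs -/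

section Estimates

variable {s : ℂ} {α : ℝ}

theorem norm_rpow_eq (hs : (p : ℝ) ^ (-α) = ‖s‖) {x : ℤ_[p]} (hx : x ≠ 0) :
    ‖x‖ ^ α = ‖s‖ ^ x.valuation := by
  have hp : (0 : ℝ) ≤ p := Nat.cast_nonneg p
  rw [PadicInt.norm_eq_zpow_neg_valuation hx, ← hs, ← Real.rpow_intCast, ← Real.rpow_mul hp,
    ← Real.rpow_mul_natCast hp]
  push_cast
  ring_nf

theorem norm_omega_sub_le_rhoHat (hα : 0 < α) (hs : (p : ℝ) ^ (-α) = ‖s‖) (hs1 : ‖s‖ < 1)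
    (m : ℕ∞) (u v : ℝ × ℤ_[p]) :
    ‖omega m s u - omega m s v‖ ≤ (1 - ‖s‖)⁻¹ * (2 * Real.pi + 2) * rhoHat p α u v := by
  obtain ⟨ξ, x⟩ := u
  obtain ⟨η, y⟩ := v
  have hc : 0 < (1 - ‖s‖)⁻¹ := inv_pos.2 (sub_pos.2 hs1)
  have h1 := norm_omega_sub_le_real hs1 m ξ η x
  have h2 : ‖omega m s (η, x) - omega m s (η, y)‖ ≤ (1 - ‖s‖)⁻¹ * 2 * ‖x - y‖ ^ α := by
    rcases eq_or_ne x y with rfl | hxy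
    · simp [Real.zero_rpow hα.ne']
    · rw [norm_rpow_eq hs (sub_ne_zero.2 hxy)]
      exact norm_omega_sub_le_padic hs1 m η
        (PadicInt.norm_eq_zpow_neg_valuation (sub_ne_zero.2 hxy)).le
  have h3 : |ξ - η| ≤ rhoHat p α (ξ, x) (η, y) := le_max_left _ _
  have h4 : ‖x - y‖ ^ α ≤ rhoHat p α (ξ, x) (η, y) := le_max_right _ _
  calc _ ≤ ‖omega m s (ξ, x) - omega m s (η, x)‖ + ‖omega m s (η, x) - omega m s (η, y)‖ :=
        norm_sub_le_norm_sub_add_norm_sub _ _ _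
    _ ≤ (1 - ‖s‖)⁻¹ * (2 * Real.pi * rhoHat p α (ξ, x) (η, y)) +
        (1 - ‖s‖)⁻¹ * 2 * rhoHat p α (ξ, x) (η, y) := by
        refine add_le_add (h1.trans ?_) (h2.trans ?_) <;> gcongr
    _ = _ := by ring

theorem isLContraction_idOmega (hα : 0 < α) (hs : (p : ℝ) ^ (-α) = ‖s‖) (hs1 : ‖s‖ < 1)
    (m : ℕ∞) : IsLContraction (rhoHat p α) dHat (idOmega (p := p) m s) := by
  have hc : 0 < (1 - ‖s‖)⁻¹ := inv_pos.2 (sub_pos.2 hs1)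
  have hpi := Real.pi_pos
  refine ⟨1 + (1 - ‖s‖)⁻¹ * (2 * Real.pi + 2), by positivity, fun u v => ?_⟩
  have h0 := rhoHat_nonneg α u v
  refine max_le ((le_max_left _ _ : _ ≤ rhoHat p α u v).trans ?_)
    ((norm_omega_sub_le_rhoHat hα hs hs1 m u v).trans ?_)
  · rw [add_mul, one_mul]
    exact le_add_of_nonneg_right (by positivity)
  · gcongr
    linarith

theorem deltaTilde_mul_le (hα : 0 < α) (hs : (p : ℝ) ^ (-α) = ‖s‖) (hs0 : s ≠ 0)
    (m : ℕ∞) (ξ : ℝ) (x y : ℤ_[p]) :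
    deltaTilde p m s * ‖x - y‖ ^ α ≤ ‖omega m s (ξ, x) - omega m s (ξ, y)‖ := by
  rcases eq_or_ne x y with rfl | hxy
  · simp [Real.zero_rpow hα.ne']
  · have h : deltaTilde p m s ≤
        ‖s ^ (-((x - y).valuation : ℤ)) * (omega m s (ξ, x) - omega m s (ξ, y))‖ :=
      csInf_le ⟨0, by rintro r ⟨_, _, _, -, rfl⟩; exact norm_nonneg _⟩ ⟨x, y, ξ, hxy, rfl⟩
    have hpos : 0 < ‖s‖ ^ (x - y).valuation := pow_pos (norm_pos_iff.2 hs0) _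
    rw [norm_rpow_eq hs (sub_ne_zero.2 hxy), ← le_div_iff₀ hpos]
    rwa [norm_mul, norm_zpow, zpow_neg, zpow_natCast, inv_mul_eq_div] at h

/-- The lower bi-Lipschitz bound: `‖x - y‖ ^ α` is bounded by the variation of `omega` in `ℤ_p`, which
is at most its total variation plus its variation in the real coordinate. -/
theorem exists_rhoHat_le_dHat_idOmega (hα : 0 < α) (hs : (p : ℝ) ^ (-α) = ‖s‖) (hs0 : s ≠ 0)
    (hs1 : ‖s‖ < 1) (m : ℕ∞) (hΔ : 0 < deltaTilde p m s) :
    ∃ C : ℝ, 0 < C ∧ ∀ u v, rhoHat p α u v ≤ C * dHat (idOmega m s u) (idOmega m s v) := by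
  have hc : 0 < (1 - ‖s‖)⁻¹ := inv_pos.2 (sub_pos.2 hs1)
  have hpi := Real.pi_pos
  have hL : 0 < (1 - ‖s‖)⁻¹ * (2 * Real.pi) := by positivity
  have hC : 0 < ((1 - ‖s‖)⁻¹ * (2 * Real.pi) + 1) / deltaTilde p m s := by positivity
  refine ⟨1 + ((1 - ‖s‖)⁻¹ * (2 * Real.pi) + 1) / deltaTilde p m s, by positivity, ?_⟩
  rintro ⟨ξ, x⟩ ⟨η, y⟩
  set T := dHat (idOmega m s (ξ, x)) (idOmega m s (η, y)) with hT
  have h0 : 0 ≤ T := dHat_nonneg _ _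
  have h1 : |ξ - η| ≤ T := le_max_left _ _
  have h2 : ‖omega m s (ξ, x) - omega m s (η, y)‖ ≤ T := le_max_right _ _
  have h3 := norm_omega_sub_le_real hs1 m η ξ y
  rw [abs_sub_comm] at h3
  have h4 := deltaTilde_mul_le hα hs hs0 m ξ x y
  have h5 := norm_sub_le_norm_sub_add_norm_sub (omega m s (ξ, x)) (omega m s (η, y))
    (omega m s (ξ, y))
  refine max_le (h1.trans ?_) ?_
  · rw [add_mul, one_mul]
    exact le_add_of_nonneg_right (by positivity)
  · have h6 : ‖x - y‖ ^ α ≤ ((1 - ‖s‖)⁻¹ * (2 * Real.pi) + 1) / deltaTilde p m s * T := by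
      rw [div_mul_eq_mul_div, le_div_iff₀' hΔ]
      nlinarith [mul_le_mul_of_nonneg_left h1 hL.le]
    refine h6.trans ?_
    gcongr
    linarith

/-! ### The surface of rotation `sigma` -/

/-- The coordinate `|a| (1 + Re (z / a))`: the signed distance of
`sigma a (w, z)` from the axis of rotation. -/
noncomputable def radius (a z : ℂ) : ℝ := ‖a‖ * (1 + (z / a).re)

theorem dist_sigma_sq (a : ℂ) (q q' : Circle × ℂ) :
    dist (sigma a q) (sigma a q') ^ 2 =
      ‖(q.1 : ℂ) * radius a q.2 - q'.1 * radius a q'.2‖ ^ 2 +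
        (‖a‖ * ((q.2 - q'.2) / a).im) ^ 2 := by
  rw [EuclideanSpace.dist_eq, Real.sq_sqrt (Finset.sum_nonneg fun i _ => sq_nonneg _),
    Fin.sum_univ_three, Complex.sq_norm, Complex.normSq_apply, sub_div]
  simp [sigma, radius, Real.dist_eq, sq_abs]
  ring

theorem abs_radius_sub_le {a : ℂ} (ha : a ≠ 0) (z z' : ℂ) :
    |radius a z - radius a z'| ≤ ‖z - z'‖ := by
  have h : radius a z - radius a z' = ‖a‖ * ((z - z') / a).re := by
    simp only [radius, sub_div, Complex.sub_re]; ring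
  rw [h, abs_mul, abs_norm]
  calc _ ≤ ‖a‖ * ‖(z - z') / a‖ := by gcongr; exact Complex.abs_re_le_norm _
    _ = ‖z - z'‖ := by rw [norm_div, mul_div_cancel₀ _ (norm_ne_zero_iff.2 ha)]

theorem abs_norm_mul_im_le {a : ℂ} (ha : a ≠ 0) (z : ℂ) : |‖a‖ * (z / a).im| ≤ ‖z‖ := by
  rw [abs_mul, abs_norm]
  calc _ ≤ ‖a‖ * ‖z / a‖ := by gcongr; exact Complex.abs_im_le_norm _
    _ = ‖z‖ := by rw [norm_div, mul_div_cancel₀ _ (norm_ne_zero_iff.2 ha)]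

theorem norm_circleExp_sub (t t' : ℝ) :
    ‖(Circle.exp t : ℂ) - Circle.exp t'‖ = 2 * |Real.sin ((t - t') / 2)| := by
  have h : Complex.exp (t * Complex.I) - Complex.exp (t' * Complex.I) =
      Complex.exp (Complex.I * t') * (Complex.exp (Complex.I * ((t - t' : ℝ) : ℂ)) - 1) := by
    rw [mul_sub, ← Complex.exp_add]
    push_cast
    ring_nf
  rw [Circle.coe_exp, Circle.coe_exp, h, norm_mul, Complex.norm_exp_I_mul_ofReal, one_mul,
    Complex.norm_exp_I_mul_ofReal_sub_one]
  simp

theorem dist_sigma_cylProj_le {a : ℂ} (ha : a ≠ 0) {R : ℝ} {c c' : ℝ × ℂ} (hc' : ‖c'.2‖ ≤ R) :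
    dist (sigma a (cylProj c)) (sigma a (cylProj c')) ≤
      (2 + 2 * Real.pi * (‖a‖ + R)) * dHat c c' := by
  have h0 := dHat_nonneg c c'
  have h1 : |c.1 - c'.1| ≤ dHat c c' := le_max_left _ _
  have h2 : ‖c.2 - c'.2‖ ≤ dHat c c' := le_max_right _ _
  have hpi := Real.pi_pos
  have hR : 0 ≤ R := (norm_nonneg _).trans hc'
  have hr' : |radius a c'.2| ≤ ‖a‖ + R := by
    have := abs_radius_sub_le ha c'.2 0
    rw [sub_zero] at this
    have h0 : radius a 0 = ‖a‖ := by simp [radius]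
    rw [h0] at this
    have h3 := abs_sub_abs_le_abs_sub (radius a c'.2) ‖a‖
    rw [abs_norm] at h3
    linarith
  have hw : ‖((cylProj c).1 : ℂ) - (cylProj c').1‖ ≤ 2 * Real.pi * dHat c c' := by
    rw [cylProj, cylProj, norm_circleExp_sub]
    have h3 : |Real.sin ((2 * Real.pi * c.1 - 2 * Real.pi * c'.1) / 2)| ≤ Real.pi * |c.1 - c'.1| := by
      refine Real.abs_sin_le_abs.trans_eq ?_
      rw [show (2 * Real.pi * c.1 - 2 * Real.pi * c'.1) / 2 = Real.pi * (c.1 - c'.1) by ring,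
        abs_mul, abs_of_pos hpi]
    nlinarith
  have hA : ‖((cylProj c).1 : ℂ) * radius a c.2 - (cylProj c').1 * radius a c'.2‖ ≤
      (1 + 2 * Real.pi * (‖a‖ + R)) * dHat c c' := by
    have h3 : ((cylProj c).1 : ℂ) * radius a c.2 - (cylProj c').1 * radius a c'.2 =
        (cylProj c).1 * ((radius a c.2 - radius a c'.2 : ℝ) : ℂ) +
          (((cylProj c).1 : ℂ) - (cylProj c').1) * radius a c'.2 := by push_cast; ring
    rw [h3]
    refine (norm_add_le _ _).trans ?_
    rw [norm_mul, norm_mul, Circle.norm_coe, one_mul, Complex.norm_real, Complex.norm_real,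
      Real.norm_eq_abs, Real.norm_eq_abs]
    have h4 := (abs_radius_sub_le ha c.2 c'.2).trans h2
    have h5 := mul_le_mul hw hr' (abs_nonneg _) (by positivity)
    linarith
  have hB := (abs_norm_mul_im_le ha (c.2 - c'.2)).trans h2
  refine abs_le_of_sq_le_sq' ?_ (by positivity) |>.2
  rw [dist_sigma_sq, show (cylProj c).2 = c.2 from rfl, show (cylProj c').2 = c'.2 from rfl,
    ← sq_abs (‖a‖ * _)]
  have := norm_nonneg (((cylProj c).1 : ℂ) * radius a c.2 - (cylProj c').1 * radius a c'.2)
  calc _ ≤ (‖((cylProj c).1 : ℂ) * radius a c.2 - (cylProj c').1 * radius a c'.2‖ +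
        |‖a‖ * ((c.2 - c'.2) / a).im|) ^ 2 := by
        nlinarith [mul_nonneg this (abs_nonneg (‖a‖ * ((c.2 - c'.2) / a).im))]
    _ ≤ _ := by
        gcongr
        linarith

/-- Away from the axis, and as long as the angles differ by at most half a turn, the Euclidean
distance controls the distance in cylindrical coordinates. -/
theorem dHat_le_dist_sigma {a : ℂ} (ha : a ≠ 0) {r : ℝ} (hr : 0 < r) {c c' : ℝ × ℂ}
    (hc : r ≤ radius a c.2) (hc' : r ≤ radius a c'.2) (h : |c.1 - c'.1| ≤ 1 / 2) :
    dHat c c' ≤ (2 + 1 / r) * dist (sigma a (cylProj c)) (sigma a (cylProj c')) := by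
  have hpi := Real.pi_pos
  set T := dist (sigma a (cylProj c)) (sigma a (cylProj c')) with hT
  have hT0 : 0 ≤ T := dist_nonneg
  have hsq := dist_sigma_sq a (cylProj c) (cylProj c')
  rw [← hT] at hsq
  set w : ℂ := ((cylProj c).1 : ℂ) with hw
  set w' : ℂ := ((cylProj c').1 : ℂ) with hw'
  have hz : (cylProj c).2 = c.2 := rfl
  have hz' : (cylProj c').2 = c'.2 := rfl
  rw [hz, hz'] at hsq
  have hA : ‖w * radius a c.2 - w' * radius a c'.2‖ ≤ T :=
    abs_le_of_sq_le_sq' (by nlinarith [sq_nonneg (‖a‖ * ((c.2 - c'.2) / a).im)]) hT0 |>.2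
  have hB : |‖a‖ * ((c.2 - c'.2) / a).im| ≤ T :=
    abs_le_of_sq_le_sq (by
      nlinarith [sq_nonneg ‖w * radius a c.2 - w' * radius a c'.2‖]) hT0
  have hnw : ‖w‖ = 1 := Circle.norm_coe _
  have hnw' : ‖w'‖ = 1 := Circle.norm_coe _
  have hrad : |radius a c.2 - radius a c'.2| ≤ T := by
    refine le_trans ?_ hA
    have := abs_norm_sub_norm_le (w * radius a c.2) (w' * radius a c'.2)
    rwa [norm_mul, norm_mul, hnw, hnw', one_mul, one_mul, Complex.norm_real, Complex.norm_real,
      Real.norm_of_nonneg (hr.le.trans hc), Real.norm_of_nonneg (hr.le.trans hc')] at this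
  have hww : ‖w - w'‖ * r ≤ 2 * T := by
    have h3 : (w - w') * radius a c.2 = (w * radius a c.2 - w' * radius a c'.2) -
        w' * ((radius a c.2 - radius a c'.2 : ℝ) : ℂ) := by push_cast; ring
    have h4 := norm_sub_le (w * radius a c.2 - w' * radius a c'.2)
      (w' * ((radius a c.2 - radius a c'.2 : ℝ) : ℂ))
    rw [← h3, norm_mul, norm_mul, hnw', one_mul, Complex.norm_real, Complex.norm_real,
      Real.norm_of_nonneg (hr.le.trans hc), Real.norm_eq_abs] at h4
    have := mul_le_mul_of_nonneg_left hc (norm_nonneg (w - w'))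
    linarith
  -- on a half turn the chord is at least `2 / π` times the arc
  have hang : 4 * |c.1 - c'.1| ≤ ‖w - w'‖ := by
    rw [hw, hw', cylProj, cylProj, norm_circleExp_sub,
      show (2 * Real.pi * c.1 - 2 * Real.pi * c'.1) / 2 = Real.pi * (c.1 - c'.1) by ring]
    have h3 : |Real.pi * (c.1 - c'.1)| ≤ Real.pi / 2 := by
      rw [abs_mul, abs_of_pos hpi]; nlinarith
    have h4 := Real.mul_abs_le_abs_sin h3
    rw [abs_mul, abs_of_pos hpi] at h4
    have h5 : 2 / Real.pi * (Real.pi * |c.1 - c'.1|) = 2 * |c.1 - c'.1| := by field_simp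
    linarith
  have hzz : ‖c.2 - c'.2‖ ≤ 2 * T := by
    have h3 : ‖c.2 - c'.2‖ = ‖a‖ * ‖(c.2 - c'.2) / a‖ := by
      rw [norm_div, mul_div_cancel₀ _ (norm_ne_zero_iff.2 ha)]
    have h4 := mul_le_mul_of_nonneg_left (Complex.norm_le_abs_re_add_abs_im ((c.2 - c'.2) / a))
      (norm_nonneg a)
    have h5 : radius a c.2 - radius a c'.2 = ‖a‖ * ((c.2 - c'.2) / a).re := by
      simp only [radius, sub_div, Complex.sub_re]; ring
    rw [h5, abs_mul, abs_norm] at hrad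
    rw [abs_mul, abs_norm] at hB
    rw [h3]
    linarith
  have hrT : 0 ≤ 1 / r * T := by positivity
  refine max_le ?_ (hzz.trans (by linarith))
  have h6 : |c.1 - c'.1| ≤ 1 / r * T := by
    rw [one_div, inv_mul_eq_div, le_div_iff₀ hr]
    nlinarith [mul_le_mul_of_nonneg_right hang hr.le, mul_nonneg (abs_nonneg (c.1 - c'.1)) hr.le]
  linarith

/-! ### The maps on the solenoid -/

theorem isLContraction_U (hα : 0 < α) (hs : (p : ℝ) ^ (-α) = ‖s‖) (hs1 : ‖s‖ < 1) (m : ℕ∞) :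
    IsLContraction (rho p α) dCyl (U (p := p) m s) := by
  obtain ⟨C, hC, h⟩ := isLContraction_idOmega (p := p) hα hs hs1 m
  exact .of_comp_proj proj_surjective
    ⟨C, hC, fun u v => (quotDist_le dHat_nonneg _ _).trans (h u v)⟩

theorem isLContraction_Omega_proj (hα : 0 < α) (hs : (p : ℝ) ^ (-α) = ‖s‖) (hs1 : ‖s‖ < 1)
    (m : ℕ∞) {a : ℂ} (ha : a ≠ 0) :
    IsLContraction (rhoHat p α) dist (Omega (p := p) m s a ∘ proj p) := by
  obtain ⟨C, hC, h⟩ := isLContraction_idOmega (p := p) hα hs hs1 m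
  have hc : 0 < (1 - ‖s‖)⁻¹ := inv_pos.2 (sub_pos.2 hs1)
  have hpi := Real.pi_pos
  refine ⟨(2 + 2 * Real.pi * (‖a‖ + (1 - ‖s‖)⁻¹)) * C, by positivity, fun u v => ?_⟩
  have h1 := dist_sigma_cylProj_le ha (c := idOmega m s u) (c' := idOmega m s v)
    (norm_omega_le hs1 m v)
  exact (h1.trans (mul_le_mul_of_nonneg_left (h u v) (by positivity))).trans_eq
    (mul_assoc _ _ _).symm

theorem isLIsometry_U (hα : 0 < α) (hs : (p : ℝ) ^ (-α) = ‖s‖) (hs0 : s ≠ 0) (hs1 : ‖s‖ < 1)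
    (m : ℕ∞) (hΔ : 0 < deltaTilde p m s) : IsLIsometry (rho p α) dCyl (U (p := p) m s) := by
  refine ⟨isLContraction_U hα hs hs1 m, ?_⟩
  obtain ⟨C, hC, h⟩ := exists_rhoHat_le_dHat_idOmega hα hs hs0 hs1 m hΔ
  refine ⟨C, hC, fun f g => ?_⟩
  obtain ⟨u, rfl⟩ := proj_surjective f
  obtain ⟨v, rfl⟩ := proj_surjective g
  rw [← div_le_iff₀' hC]
  refine le_quotDist fun c c' hc hc' => ?_
  obtain ⟨u', hu', rfl⟩ := exists_lift_of_cylProj_eq m s u hc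
  obtain ⟨v', hv', rfl⟩ := exists_lift_of_cylProj_eq m s v hc'
  rw [div_le_iff₀' hC, ← hu', ← hv']
  exact (quotDist_le (rhoHat_nonneg α) u' v').trans (h u' v')

theorem le_radius_omega (hs1 : ‖s‖ < 1) (m : ℕ∞) (a : ℂ) (u : ℝ × ℤ_[p]) :
    ‖a‖ * (1 - gamma p m s a) ≤ radius a (omega m s u) := by
  have hbdd : BddBelow (Set.range fun u : ℝ × ℤ_[p] => (omega m s u / a).re) := by
    refine ⟨-((1 - ‖s‖)⁻¹ / ‖a‖), ?_⟩
    rintro _ ⟨u, rfl⟩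
    refine (abs_le.1 ((Complex.abs_re_le_norm _).trans ?_)).1
    rw [norm_div]
    exact div_le_div_of_nonneg_right (norm_omega_le hs1 m u) (norm_nonneg a)
  have h := ciInf_le hbdd u
  unfold radius gamma
  gcongr
  linarith

/-- The local bi-Lipschitz estimate: it holds for representatives whose real coordinates differ
by at most `1 / 2`. -/
theorem exists_rhoHat_le_dist_Omega (hα : 0 < α) (hs : (p : ℝ) ^ (-α) = ‖s‖) (hs0 : s ≠ 0)
    (hs1 : ‖s‖ < 1) (m : ℕ∞) (hΔ : 0 < deltaTilde p m s) {a : ℂ} (ha : a ≠ 0)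
    (hγ : gamma p m s a < 1) :
    ∃ C : ℝ, 0 < C ∧ ∀ u v : ℝ × ℤ_[p], |u.1 - v.1| ≤ 1 / 2 →
      rhoHat p α u v ≤ C * dist (Omega m s a (proj p u)) (Omega m s a (proj p v)) := by
  obtain ⟨C, hC, h⟩ := exists_rhoHat_le_dHat_idOmega hα hs hs0 hs1 m hΔ
  have hr : 0 < ‖a‖ * (1 - gamma p m s a) := mul_pos (norm_pos_iff.2 ha) (sub_pos.2 hγ)
  refine ⟨C * (2 + 1 / (‖a‖ * (1 - gamma p m s a))), by positivity, fun u v huv => ?_⟩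
  refine (h u v).trans ?_
  rw [mul_assoc]
  gcongr
  exact dHat_le_dist_sigma ha hr (le_radius_omega hs1 m a u) (le_radius_omega hs1 m a v) huv

theorem isLIsometry_Omega (hα : 0 < α) (hs : (p : ℝ) ^ (-α) = ‖s‖) (hs0 : s ≠ 0)
    (hs1 : ‖s‖ < 1) (m : ℕ∞) (hΔ : 0 < deltaTilde p m s) {a : ℂ} (ha : a ≠ 0)
    (hγ : gamma p m s a < 1) : IsLIsometry (rho p α) dist (Omega (p := p) m s a) := by
  refine ⟨.of_comp_proj proj_surjective (isLContraction_Omega_proj hα hs hs1 m ha), ?_⟩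
  obtain ⟨C, hC, h⟩ := exists_rhoHat_le_dist_Omega hα hs hs0 hs1 m hΔ ha hγ
  refine ⟨C, hC, fun f g => ?_⟩
  obtain ⟨u, rfl⟩ := proj_surjective f
  obtain ⟨v, rfl⟩ := proj_surjective g
  rw [← proj_shift v (round (u.1 - v.1))]
  refine (quotDist_le (rhoHat_nonneg α) _ _).trans (h _ _ ?_)
  rw [← sub_sub]
  exact abs_sub_round _

theorem continuous_Omega_proj (hα : 0 < α) (hs : (p : ℝ) ^ (-α) = ‖s‖) (hs1 : ‖s‖ < 1)
    (m : ℕ∞) {a : ℂ} (ha : a ≠ 0) : Continuous fun u => Omega (p := p) m s a (proj p u) := by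
  obtain ⟨C, hC, h⟩ := isLContraction_Omega_proj (p := p) hα hs hs1 m ha
  refine continuous_iff_continuousAt.2 fun v => tendsto_iff_dist_tendsto_zero.2 ?_
  refine squeeze_zero (fun _ => dist_nonneg) (fun u => h u v) ?_
  have h1 : Continuous fun u : ℝ × ℤ_[p] => C * rhoHat p α u v := by
    unfold rhoHat
    have := (continuous_snd (X := ℝ) (Y := ℤ_[p])).sub (continuous_const (y := v.2)) |>.norm
      |>.rpow_const (p := α) fun _ => Or.inr hα.le
    fun_prop
  simpa [rhoHat, Real.zero_rpow hα.ne'] using h1.tendsto v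

theorem exists_mem_Ico_proj_eq (f : Solenoid p) : ∃ u, u.1 ∈ Set.Ico (0 : ℝ) 1 ∧ proj p u = f := by
  obtain ⟨u, rfl⟩ := proj_surjective f
  refine ⟨_, ?_, proj_shift u (-⌊u.1⌋)⟩
  have h1 := Int.floor_le u.1
  have h2 := Int.lt_floor_add_one u.1
  simp only [Int.cast_neg, Set.mem_Ico]
  constructor <;> linarith

instance compactSpace_solenoid : CompactSpace (Solenoid p) := by
  have h : proj p '' (Set.Icc 0 1 ×ˢ Set.univ) = Set.univ := by
    refine Set.eq_univ_of_forall fun f => ?_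
    obtain ⟨u, hu, rfl⟩ := exists_mem_Ico_proj_eq f
    exact ⟨u, ⟨Set.Ico_subset_Icc_self hu, Set.mem_univ _⟩, rfl⟩
  rw [← isCompact_univ_iff, ← h]
  exact (isCompact_Icc.prod isCompact_univ).image continuous_quot_mk

theorem isEmbedding_Omega (hα : 0 < α) (hs : (p : ℝ) ^ (-α) = ‖s‖) (hs0 : s ≠ 0)
    (hs1 : ‖s‖ < 1) (m : ℕ∞) (hΔ : 0 < deltaTilde p m s) {a : ℂ} (ha : a ≠ 0)
    (hγ : gamma p m s a < 1) : Topology.IsEmbedding (Omega (p := p) m s a) := by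
  have hcont : Continuous (Omega (p := p) m s a) :=
    isQuotientMap_quot_mk.continuous_iff.2 (continuous_Omega_proj hα hs hs1 m ha)
  refine (hcont.isClosedEmbedding ?_).isEmbedding
  obtain ⟨C, hC, h⟩ := exists_rhoHat_le_dist_Omega hα hs hs0 hs1 m hΔ ha hγ
  intro f g hfg
  obtain ⟨u, rfl⟩ := proj_surjective f
  obtain ⟨v, rfl⟩ := proj_surjective g
  rw [← proj_shift v (round (u.1 - v.1))] at hfg ⊢
  have h1 := h u (v.1 + round (u.1 - v.1), v.2 - ((round (u.1 - v.1) : ℤ) : ℤ_[p]))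
    (by rw [← sub_sub]; exact abs_sub_round _)
  rw [hfg, dist_self, mul_zero] at h1
  obtain ⟨h2, h3⟩ := max_le_iff.1 h1
  congr 1
  refine Prod.ext (sub_eq_zero.1 (abs_nonpos_iff.1 h2)) (sub_eq_zero.1 (norm_le_zero_iff.1 ?_))
  by_contra hne
  exact (Real.rpow_pos_of_pos (not_le.1 hne) α).not_ge h3

end Estimates

/-! ### Invariant measure of small subsets of `ℤ_p` -/

section Haar

variable [MeasurableSpace ℤ_[p]] [BorelSpace ℤ_[p]] (μ : Measure ℤ_[p]) [IsProbabilityMeasure μ]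
  [μ.IsAddLeftInvariant]

/-- `ℤ_p` is the disjoint union of `p ^ N` translates of `p ^ N ℤ_p`. -/
theorem measure_closedBall_zero (N : ℕ) :
    μ (Metric.closedBall 0 ((p : ℝ) ^ (-N : ℤ))) = ((p : ENNReal) ^ N)⁻¹ := by
  have hball : ∀ k < p ^ N, {y : ℤ_[p] | y.appr N = k} =
      (fun y => -(k : ℤ_[p]) + y) ⁻¹' Metric.closedBall 0 ((p : ℝ) ^ (-N : ℤ)) := by
    intro k hk
    ext y
    simp only [Set.mem_ofPred_eq, Set.mem_preimage, mem_closedBall_zero_iff, neg_add_eq_sub]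
    rw [PadicInt.norm_le_pow_iff_mem_span_pow]
    exact ⟨fun h => h ▸ PadicInt.appr_spec N y, appr_eq_of_sub_mem hk⟩
  have hsum : μ (⋃ k ∈ Finset.range (p ^ N), {y : ℤ_[p] | y.appr N = k}) =
      (p : ENNReal) ^ N * μ (Metric.closedBall 0 ((p : ℝ) ^ (-N : ℤ))) := by
    rw [measure_biUnion_finset]
    · have h : ∀ k ∈ Finset.range (p ^ N), μ {y : ℤ_[p] | y.appr N = k} =
          μ (Metric.closedBall 0 ((p : ℝ) ^ (-N : ℤ))) := by
        intro k hk
        rw [hball k (Finset.mem_range.1 hk), measure_preimage_add]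
      rw [Finset.sum_congr rfl h]
      simp
    · intro i _ j _ hij
      exact Set.disjoint_left.2 fun y (hi : y.appr N = i) (hj : y.appr N = j) =>
        hij (hi.symm.trans hj)
    · intro k hk
      rw [hball k (Finset.mem_range.1 hk)]
      exact (measurable_const_add _) Metric.isClosed_closedBall.measurableSet
  have huniv : (⋃ k ∈ Finset.range (p ^ N), {y : ℤ_[p] | y.appr N = k}) = Set.univ :=
    Set.eq_univ_of_forall fun y => by simpa using PadicInt.appr_lt y N
  rw [huniv, measure_univ] at hsum
  exact ENNReal.eq_inv_of_mul_eq_one_left (by rw [mul_comm]; exact hsum.symm)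

theorem measure_le_of_norm_sub_le {E : Set ℤ_[p]} {t : ℝ} (ht : 0 < t)
    (hE : ∀ x ∈ E, ∀ y ∈ E, ‖x - y‖ ≤ t) : μ E ≤ ENNReal.ofReal (p * t) := by
  have hp1 : (1 : ℝ) < p := by exact_mod_cast (Fact.out : p.Prime).one_lt
  have hp0 : (0 : ℝ) < p := zero_lt_one.trans hp1
  rcases le_total 1 t with h1 | h1
  · refine prob_le_one.trans ?_
    rw [ENNReal.one_le_ofReal]
    nlinarith
  rcases E.eq_empty_or_nonempty with rfl | ⟨x, hx⟩
  · simp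
  obtain ⟨N, hN1, hN2⟩ := exists_nat_pow_near_of_lt_one ht h1 (inv_pos.2 hp0)
    (inv_lt_one_of_one_lt₀ hp1)
  have hsub : E ⊆ (fun y => -x + y) ⁻¹' Metric.closedBall 0 ((p : ℝ) ^ (-N : ℤ)) := by
    intro y hy
    simp only [Set.mem_preimage, mem_closedBall_zero_iff, neg_add_eq_sub]
    refine (hE y hy x hx).trans (hN2.trans_eq ?_)
    rw [zpow_neg, zpow_natCast, inv_pow]
  refine (measure_mono hsub).trans ?_
  rw [measure_preimage_add, measure_closedBall_zero]
  have h2 : ((p : ENNReal) ^ N)⁻¹ = ENNReal.ofReal ((p : ℝ)⁻¹ ^ N) := by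
    rw [inv_pow, ENNReal.ofReal_inv_of_pos (by positivity), ENNReal.ofReal_pow hp0.le,
      ENNReal.ofReal_natCast]
  rw [h2]
  refine ENNReal.ofReal_le_ofReal ?_
  calc (p : ℝ)⁻¹ ^ N = p * (p : ℝ)⁻¹ ^ (N + 1) := by rw [pow_succ]; field_simp
    _ ≤ p * t := by gcongr

end Haar

/-! ### Hausdorff dimension of Lipschitz and bi-Lipschitz images of `ℝ × ℤ_p` -/

section Dimension

variable {Y : Type*} [MetricSpace Y] {F : ℝ × ℤ_[p] → Y} {α C : ℝ}

/-- The cells `[k t, (k + 1) t) × (j + p ^ N ℤ_p)` with `t = p ^ (-α N)` have diameter at most `t`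
for `rhoHat`, and about `p ^ N / t = t ^ (-(1 / α + 1))` of them cover `[0, 1) × ℤ_p`. -/
theorem hausdorffMeasure_image_ne_top [MeasurableSpace Y] [BorelSpace Y] (hα : 0 < α) (hC : 0 < C)
    (hF : ∀ u v, dist (F u) (F v) ≤ C * rhoHat p α u v) :
    μH[1 / α + 1] (F '' (Set.Ico 0 1 ×ˢ Set.univ)) ≠ ⊤ := by
  have hp1 : (1 : ℝ) < p := by exact_mod_cast (Fact.out : p.Prime).one_lt
  have hp0 : (0 : ℝ) < p := zero_lt_one.trans hp1
  set q : ℝ := (p : ℝ) ^ (-α) with hq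
  have hq0 : 0 < q := Real.rpow_pos_of_pos hp0 _
  have hq1 : q < 1 := Real.rpow_lt_one_of_one_lt_of_neg hp1 (neg_lt_zero.2 hα)
  have hqN : ∀ N : ℕ, ((p : ℝ) ^ (-N : ℤ)) ^ α = q ^ N := by
    intro N
    rw [← Real.rpow_intCast, ← Real.rpow_mul hp0.le, hq, ← Real.rpow_mul_natCast hp0.le]
    push_cast
    ring_nf
  have hqD : ∀ N : ℕ, (q ^ N) ^ (1 / α) = ((p : ℝ) ^ N)⁻¹ := by
    intro N
    rw [← hqN, ← Real.rpow_mul (by positivity), mul_one_div_cancel hα.ne', Real.rpow_one, zpow_neg,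
      zpow_natCast]
  let cell : ∀ N : ℕ, Fin (⌊1 / q ^ N⌋₊ + 1) × Fin (p ^ N) → Set Y := fun N i =>
    F '' {u | 0 ≤ u.1 ∧ ⌊u.1 / q ^ N⌋₊ = i.1 ∧ u.2.appr N = i.2}
  have hdiam : ∀ N i, Metric.ediam (cell N i) ≤ ENNReal.ofReal (C * q ^ N) := by
    intro N i
    have ht : 0 < q ^ N := pow_pos hq0 N
    refine Metric.ediam_le ?_
    rintro _ ⟨u, ⟨hu0, hu1, hu2⟩, rfl⟩ _ ⟨v, ⟨hv0, hv1, hv2⟩, rfl⟩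
    rw [edist_dist]
    refine ENNReal.ofReal_le_ofReal ((hF u v).trans ?_)
    gcongr
    refine max_le ?_ ?_
    · have h1 := Nat.floor_le (div_nonneg hu0 ht.le)
      have h2 := Nat.lt_floor_add_one (u.1 / q ^ N)
      have h3 := Nat.floor_le (div_nonneg hv0 ht.le)
      have h4 := Nat.lt_floor_add_one (v.1 / q ^ N)
      rw [hu1] at h1 h2
      rw [hv1] at h3 h4
      have h5 : |u.1 / q ^ N - v.1 / q ^ N| ≤ 1 := abs_le.2 ⟨by linarith, by linarith⟩
      rwa [← sub_div, abs_div, abs_of_pos ht, div_le_one ht] at h5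
    · rw [← hqN]
      refine Real.rpow_le_rpow (norm_nonneg _) ?_ hα.le
      rw [PadicInt.norm_le_pow_iff_mem_span_pow]
      have h1 := sub_mem (PadicInt.appr_spec N u.2) (PadicInt.appr_spec N v.2)
      rwa [hu2, hv2, sub_sub_sub_cancel_right] at h1
  have hcover : ∀ N, F '' (Set.Ico 0 1 ×ˢ Set.univ) ⊆ ⋃ i, cell N i := by
    rintro N _ ⟨u, ⟨hu, -⟩, rfl⟩
    refine Set.mem_iUnion.2 ⟨(⟨⌊u.1 / q ^ N⌋₊, Nat.lt_succ_of_le (Nat.floor_le_floor ?_)⟩,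
      ⟨u.2.appr N, PadicInt.appr_lt _ _⟩), u, ⟨hu.1, rfl, rfl⟩, rfl⟩
    have := hu.2.le
    gcongr
  have hlim : Tendsto (fun N : ℕ => ENNReal.ofReal (C * q ^ N)) atTop (𝓝 0) := by
    have h := (tendsto_pow_atTop_nhds_zero_of_lt_one hq0.le hq1).const_mul C
    rw [mul_zero] at h
    simpa using ENNReal.tendsto_ofReal h
  have hsum : ∀ N, ∑ i, Metric.ediam (cell N i) ^ (1 / α + 1) ≤
      ENNReal.ofReal (2 * C ^ (1 / α + 1)) := by
    intro N
    have ht : 0 < q ^ N := pow_pos hq0 N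
    have ht1 : q ^ N ≤ 1 := pow_le_one₀ hq0.le hq1.le
    have hD : 0 ≤ 1 / α + 1 := by positivity
    calc _ ≤ ∑ i : Fin (⌊1 / q ^ N⌋₊ + 1) × Fin (p ^ N),
          ENNReal.ofReal ((C * q ^ N) ^ (1 / α + 1)) := by
          refine Finset.sum_le_sum fun i _ => ?_
          rw [← ENNReal.ofReal_rpow_of_pos (mul_pos hC ht)]
          exact ENNReal.rpow_le_rpow (hdiam N i) hD
      _ = ENNReal.ofReal (((⌊1 / q ^ N⌋₊ + 1) * p ^ N : ℝ) * (C * q ^ N) ^ (1 / α + 1)) := by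
          rw [Finset.sum_const, Finset.card_univ, Fintype.card_prod, Fintype.card_fin,
            Fintype.card_fin, nsmul_eq_mul, ENNReal.ofReal_mul (by positivity),
            ← ENNReal.ofReal_natCast]
          push_cast
          rfl
      _ ≤ _ := by
          refine ENNReal.ofReal_le_ofReal ?_
          have h1 : (⌊1 / q ^ N⌋₊ + 1 : ℝ) ≤ 2 / q ^ N := by
            have h2 := Nat.floor_le (show 0 ≤ 1 / q ^ N by positivity)
            have h3 : 1 ≤ 1 / q ^ N := (one_le_div ht).2 ht1
            rw [show 2 / q ^ N = 1 / q ^ N + 1 / q ^ N by ring]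
            linarith
          rw [Real.mul_rpow hC.le ht.le, Real.rpow_add_one ht.ne', hqD]
          calc _ ≤ 2 / q ^ N * p ^ N * (C ^ (1 / α + 1) * (((p : ℝ) ^ N)⁻¹ * q ^ N)) := by gcongr
            _ = _ := by field_simp
  refine ne_top_of_le_ne_top (ENNReal.ofReal_ne_top (r := 2 * C ^ (1 / α + 1)))
    ((Measure.hausdorffMeasure_le_liminf_sum _ _ _ hlim cell (.of_forall hdiam)
      (.of_forall hcover)).trans ?_)
  exact liminf_le_of_frequently_le' (Eventually.of_forall hsum).frequently

/-- Mass distribution: push forward the product of Lebesgue and Haar measure. A set of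
diameter `r` in the image pulls back into a product of an interval of length `O(r)` and a ball of
`ℤ_p` of Haar measure `O(r ^ (1 / α))`. -/
theorem hausdorffMeasure_image_ne_zero [MeasurableSpace Y] [BorelSpace Y] (hα : 0 < α) (hC : 0 < C)
    (hcont : Continuous F)
    (hF : ∀ u v, |u.1 - v.1| ≤ 1 / 2 → rhoHat p α u v ≤ C * dist (F u) (F v))
    {V : Set (ℝ × ℤ_[p])} (hV : IsOpen V) (hne : V.Nonempty) :
    μH[1 / α + 1] (F '' V) ≠ 0 := by
  obtain ⟨u₀, hu₀⟩ := hne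
  let _ : MeasurableSpace ℤ_[p] := borel _
  have : BorelSpace ℤ_[p] := ⟨rfl⟩
  let μ : Measure ℤ_[p] := Measure.addHaarMeasure ⊤
  have : IsProbabilityMeasure μ := ⟨by
    simpa using Measure.addHaarMeasure_self (K₀ := (⊤ : TopologicalSpace.PositiveCompacts ℤ_[p]))⟩
  have hp0 : (0 : ℝ) < p := by exact_mod_cast (Fact.out : p.Prime).pos
  -- shrink `V` so that the local estimate applies to all pairs of points
  let W : Set (ℝ × ℤ_[p]) := V ∩ (Metric.ball u₀.1 (1 / 4) ×ˢ Set.univ)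
  have hWo : IsOpen W := hV.inter (Metric.isOpen_ball.prod isOpen_univ)
  have hWne : W.Nonempty := ⟨u₀, hu₀, Metric.mem_ball_self (by norm_num), Set.mem_univ _⟩
  have hW : ∀ u ∈ W, ∀ v ∈ W, |u.1 - v.1| ≤ 1 / 2 := by
    rintro u ⟨-, hu, -⟩ v ⟨-, hv, -⟩
    have h1 := Metric.mem_ball.1 hu
    have h2 := Metric.mem_ball'.1 hv
    have h3 := dist_triangle u.1 u₀.1 v.1
    rw [Real.dist_eq u.1 v.1] at h3
    linarith
  let ν : Measure Y := (((volume : Measure ℝ).prod μ).restrict W).map F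
  set K : ℝ := C * (p * C ^ (1 / α)) with hK
  have hK0 : 0 < K := by positivity
  have hν : ∀ E : Set Y, Metric.ediam E ≤ 1 →
      ν E ≤ ENNReal.ofReal K * Metric.ediam E ^ (1 / α + 1) := by
    intro E hE1
    -- pass to the closure, which is measurable and has the same diameter
    rw [← Metric.ediam_closure] at hE1 ⊢
    refine (measure_mono subset_closure).trans ?_
    rw [Measure.map_apply hcont.measurable isClosed_closure.measurableSet,
      Measure.restrict_apply (hcont.measurable isClosed_closure.measurableSet)]
    set G : Set (ℝ × ℤ_[p]) := F ⁻¹' closure E ∩ W with hG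
    have hfin : Metric.ediam (closure E) ≠ ⊤ := ne_top_of_le_ne_top ENNReal.one_ne_top hE1
    set r : ℝ := Metric.diam (closure E) with hr
    have hr0 : 0 ≤ r := Metric.diam_nonneg
    have hEr : Metric.ediam (closure E) = ENNReal.ofReal r := (ENNReal.ofReal_toReal hfin).symm
    have hGr : ∀ u ∈ G, ∀ v ∈ G, rhoHat p α u v ≤ C * r := by
      intro u hu v hv
      refine (hF u v (hW u hu.2 v hv.2)).trans ?_
      gcongr
      exact Metric.dist_le_diam_of_mem' hfin hu.1 hv.1
    have hfst : volume (Prod.fst '' G) ≤ ENNReal.ofReal (C * r) := by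
      refine (Real.volume_le_diam _).trans (Metric.ediam_le ?_)
      rintro _ ⟨u, hu, rfl⟩ _ ⟨v, hv, rfl⟩
      rw [edist_dist, Real.dist_eq]
      exact ENNReal.ofReal_le_ofReal ((le_max_left _ _).trans (hGr u hu v hv))
    have hprod : (volume.prod μ) G ≤ volume (Prod.fst '' G) * μ (Prod.snd '' G) := by
      rw [← Measure.prod_prod]
      exact measure_mono fun u hu => ⟨⟨u, hu, rfl⟩, ⟨u, hu, rfl⟩⟩
    refine hprod.trans ?_
    rcases hr0.eq_or_lt with h0 | h0
    · -- for `r = 0` the interval is a point, a null set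
      rw [← h0, mul_zero, ENNReal.ofReal_zero] at hfst
      rw [nonpos_iff_eq_zero.1 hfst, zero_mul]
      exact zero_le
    have hCr : 0 < C * r := mul_pos hC h0
    have hsnd : μ (Prod.snd '' G) ≤ ENNReal.ofReal (p * (C * r) ^ (1 / α)) := by
      refine measure_le_of_norm_sub_le μ (Real.rpow_pos_of_pos hCr _) ?_
      rintro _ ⟨u, hu, rfl⟩ _ ⟨v, hv, rfl⟩
      have h1 : ‖u.2 - v.2‖ ^ α ≤ C * r := (le_max_right _ _).trans (hGr u hu v hv)
      have h2 := Real.rpow_le_rpow (by positivity) h1 (show 0 ≤ 1 / α by positivity)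
      rwa [← Real.rpow_mul (norm_nonneg _), mul_one_div_cancel hα.ne', Real.rpow_one] at h2
    refine (mul_le_mul' hfst hsnd).trans_eq ?_
    rw [hEr, ENNReal.ofReal_rpow_of_pos h0, ← ENNReal.ofReal_mul hCr.le, ← ENNReal.ofReal_mul hK0.le,
      Real.rpow_add_one h0.ne', Real.mul_rpow hC.le h0.le, hK]
    ring_nf
  have hle : (ENNReal.ofReal K)⁻¹ • ν ≤ μH[1 / α + 1] := by
    refine Measure.le_hausdorffMeasure _ _ 1 one_pos fun E hE => ?_
    rw [Measure.smul_apply, smul_eq_mul, ENNReal.inv_mul_le_iff (by simpa using hK0)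
      ENNReal.ofReal_ne_top]
    exact hν E hE
  have hpos : 0 < ν (F '' V) := by
    refine lt_of_lt_of_le ?_ (Measure.le_map_apply hcont.aemeasurable _)
    rw [Measure.restrict_apply_superset
      (Set.inter_subset_left.trans (Set.subset_preimage_image F V))]
    exact hWo.measure_pos _ hWne
  refine ne_of_gt (lt_of_lt_of_le ?_ (hle (F '' V)))
  rw [Measure.smul_apply, smul_eq_mul]
  exact ENNReal.mul_pos (ENNReal.inv_ne_zero.2 ENNReal.ofReal_ne_top) hpos.ne'

theorem dimH_image_le (hα : 0 < α) (hC : 0 < C)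
    (hF : ∀ u v, dist (F u) (F v) ≤ C * rhoHat p α u v) :
    dimH (F '' (Set.Ico 0 1 ×ˢ Set.univ)) ≤ ENNReal.ofReal (1 / α + 1) := by
  borelize Y
  refine dimH_le_of_hausdorffMeasure_ne_top ?_
  rw [Real.coe_toNNReal _ (by positivity)]
  exact hausdorffMeasure_image_ne_top hα hC hF

theorem le_dimH_image (hα : 0 < α) (hC : 0 < C) (hcont : Continuous F)
    (hF : ∀ u v, |u.1 - v.1| ≤ 1 / 2 → rhoHat p α u v ≤ C * dist (F u) (F v))
    {V : Set (ℝ × ℤ_[p])} (hV : IsOpen V) (hne : V.Nonempty) :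
    ENNReal.ofReal (1 / α + 1) ≤ dimH (F '' V) := by
  borelize Y
  refine le_dimH_of_hausdorffMeasure_ne_zero ?_
  rw [Real.coe_toNNReal _ (by positivity)]
  exact hausdorffMeasure_image_ne_zero hα hC hcont hF hV hne

end Dimension

/-! ### The dimension of the image of the solenoid -/

theorem range_Omega_eq (m : ℕ∞) (s a : ℂ) :
    Set.range (Omega (p := p) m s a) =
      (fun u => Omega m s a (proj p u)) '' (Set.Ico 0 1 ×ˢ Set.univ) := by
  refine Set.Subset.antisymm ?_ ?_
  · rintro _ ⟨f, rfl⟩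
    obtain ⟨u, hu, rfl⟩ := exists_mem_Ico_proj_eq f
    exact ⟨u, ⟨hu, Set.mem_univ _⟩, rfl⟩
  · rintro _ ⟨u, -, rfl⟩
    exact ⟨_, rfl⟩

theorem dimH_range_Omega_le {s : ℂ} {α : ℝ} (hα : 0 < α) (hs : (p : ℝ) ^ (-α) = ‖s‖)
    (hs1 : ‖s‖ < 1) (m : ℕ∞) {a : ℂ} (ha : a ≠ 0) :
    dimH (Set.range (Omega (p := p) m s a)) ≤ ENNReal.ofReal (1 / α + 1) := by
  obtain ⟨C, hC, h⟩ := isLContraction_Omega_proj (p := p) hα hs hs1 m ha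
  rw [range_Omega_eq]
  exact dimH_image_le hα hC h

theorem le_dimH_range_Omega_inter {s : ℂ} {α : ℝ} (hα : 0 < α) (hs : (p : ℝ) ^ (-α) = ‖s‖)
    (hs0 : s ≠ 0) (hs1 : ‖s‖ < 1) (m : ℕ∞) (hΔ : 0 < deltaTilde p m s) {a : ℂ} (ha : a ≠ 0)
    (hγ : gamma p m s a < 1) {O : Set (EuclideanSpace ℝ (Fin 3))} (hO : IsOpen O)
    (hne : (Set.range (Omega (p := p) m s a) ∩ O).Nonempty) :
    ENNReal.ofReal (1 / α + 1) ≤ dimH (Set.range (Omega (p := p) m s a) ∩ O) := by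
  obtain ⟨C, hC, h⟩ := exists_rhoHat_le_dist_Omega hα hs hs0 hs1 m hΔ ha hγ
  have hcont := continuous_Omega_proj (p := p) hα hs hs1 m ha
  have hne' : ((fun u => Omega m s a (proj p u)) ⁻¹' O).Nonempty := by
    obtain ⟨_, ⟨f, rfl⟩, hf⟩ := hne
    obtain ⟨u, rfl⟩ := proj_surjective f
    exact ⟨u, hf⟩
  refine (le_dimH_image hα hC hcont h (hO.preimage hcont) hne').trans (dimH_mono ?_)
  rintro _ ⟨u, hu, rfl⟩
  exact ⟨⟨_, rfl⟩, hu⟩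

theorem rpow_neg_one_div_scalingDim {s : ℂ} (hs0 : s ≠ 0) :
    (p : ℝ) ^ (-(1 / scalingDim p s)) = ‖s‖ := by
  have hp : 1 < (p : ℝ) := by exact_mod_cast (Fact.out : p.Prime).one_lt
  rw [scalingDim, one_div, inv_neg, inv_inv, neg_neg,
    Real.rpow_logb (zero_lt_one.trans hp) hp.ne' (norm_pos_iff.2 hs0)]

theorem scalingDim_pos {s : ℂ} (hs0 : s ≠ 0) (hs1 : ‖s‖ < 1) : 0 < scalingDim p s := by
  have hp : 1 < (p : ℝ) := by exact_mod_cast (Fact.out : p.Prime).one_lt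
  rw [scalingDim, neg_pos, inv_lt_zero]
  exact Real.logb_neg hp (norm_pos_iff.2 hs0) hs1

end PadicSolenoid

theorem theorem8 (p : ℕ) [Fact p.Prime] (m : ℕ∞) (s : ℂ) (hs0 : s ≠ 0) (hs1 : ‖s‖ < 1)
    (α : ℝ) (hα : α = 1 / PadicSolenoid.scalingDim p s) :
    (PadicSolenoid.IsLContraction (PadicSolenoid.rhoHat p α) PadicSolenoid.dHat
        (PadicSolenoid.idOmega (p := p) m s) ∧
      PadicSolenoid.IsLContraction (PadicSolenoid.rho p α) PadicSolenoid.dCyl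
        (PadicSolenoid.U (p := p) m s) ∧
      ∀ a : ℂ, a ≠ 0 →
        PadicSolenoid.IsLContraction (PadicSolenoid.rho p α) dist
          (PadicSolenoid.Omega (p := p) m s a)) ∧
    (0 < PadicSolenoid.deltaTilde p m s →
      PadicSolenoid.IsLIsometry (PadicSolenoid.rhoHat p α) PadicSolenoid.dHat
        (PadicSolenoid.idOmega (p := p) m s) ∧
      PadicSolenoid.IsLIsometry (PadicSolenoid.rho p α) PadicSolenoid.dCyl
        (PadicSolenoid.U (p := p) m s) ∧
      ∀ a : ℂ, a ≠ 0 → PadicSolenoid.gamma p m s a < 1 →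
        PadicSolenoid.IsLIsometry (PadicSolenoid.rho p α) dist
          (PadicSolenoid.Omega (p := p) m s a) ∧
        Topology.IsEmbedding (PadicSolenoid.Omega (p := p) m s a) ∧
        dimH (Set.range (PadicSolenoid.Omega (p := p) m s a)) =
          ENNReal.ofReal (PadicSolenoid.scalingDim p s + 1) ∧
        ∀ P ∈ Set.range (PadicSolenoid.Omega (p := p) m s a),
          PadicSolenoid.localDimH (Set.range (PadicSolenoid.Omega (p := p) m s a)) P =
            ENNReal.ofReal (PadicSolenoid.scalingDim p s + 1)) := by
  have hD := PadicSolenoid.scalingDim_pos (p := p) hs0 hs1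
  have hα0 : 0 < α := hα ▸ one_div_pos.2 hD
  have hs : (p : ℝ) ^ (-α) = ‖s‖ := hα ▸ PadicSolenoid.rpow_neg_one_div_scalingDim hs0
  have hDα : PadicSolenoid.scalingDim p s = 1 / α := by rw [hα, one_div_one_div]
  refine ⟨⟨PadicSolenoid.isLContraction_idOmega hα0 hs hs1 m,
    PadicSolenoid.isLContraction_U hα0 hs hs1 m, fun a ha =>
      .of_comp_proj PadicSolenoid.proj_surjective
        (PadicSolenoid.isLContraction_Omega_proj hα0 hs hs1 m ha)⟩, fun hΔ =>
    ⟨⟨PadicSolenoid.isLContraction_idOmega hα0 hs hs1 m,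
      PadicSolenoid.exists_rhoHat_le_dHat_idOmega hα0 hs hs0 hs1 m hΔ⟩,
    PadicSolenoid.isLIsometry_U hα0 hs hs0 hs1 m hΔ, fun a ha hγ =>
    ⟨PadicSolenoid.isLIsometry_Omega hα0 hs hs0 hs1 m hΔ ha hγ,
      PadicSolenoid.isEmbedding_Omega hα0 hs hs0 hs1 m hΔ ha hγ, ?_, fun P hP => ?_⟩⟩⟩
  · rw [hDα]
    refine le_antisymm (PadicSolenoid.dimH_range_Omega_le hα0 hs hs1 m ha) ?_
    rw [← Set.inter_univ (Set.range _)]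
    exact PadicSolenoid.le_dimH_range_Omega_inter hα0 hs hs0 hs1 m hΔ ha hγ isOpen_univ
      ⟨_, ⟨PadicSolenoid.proj p 0, rfl⟩, Set.mem_univ _⟩
  · rw [hDα]
    refine le_antisymm ?_ (le_iInf₂ fun O hO => le_iInf fun hPO =>
      PadicSolenoid.le_dimH_range_Omega_inter hα0 hs hs0 hs1 m hΔ ha hγ hO ⟨P, hP, hPO⟩)
    refine (iInf₂_le_of_le Set.univ isOpen_univ (iInf_le _ (Set.mem_univ P))).trans ?_
    exact (dimH_mono Set.inter_subset_left).trans
      (PadicSolenoid.dimH_range_Omega_le hα0 hs hs1 m ha)
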